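/- All graphs are finite and simple. For a graph $G$ let $A(G)$ be its adjacency matrix and $D(G)$ its diagonal degree matrix; let $\rho(G)$ be the largest modulus of an eigenvalue of $A(G)$, and let $q(G)$ be the largest eigenvalue of $A(G)+D(G)$. Write $\vee$ for the join and $\cup$ for the disjoint union of graphs. For integers $n\ge 3$ and $k\ge 1$ let $\mathcal{G}_{n,k}$ be the class of all $n$-vertex graphs with minimum degree at least $k$ that contain no Hamilton cycle, and for $\mathcal{P}\in\{\rho,q\}$ let $\operatorname{SPEX}_{\mathcal{P}}(n,C_n;\delta\ge k)$ be the set of those $G\in\mathcal{G}_{n,k}$ with $\mathcal{P}(G')\le\mathcal{P}(G)$ for all $G'\in\mathcal{G}_{n,k}$. Theorem. Let $n\ge 3$ and $k\ge 1$ be integers. (i) If $n\ge 2k+1$, then $$\max\{\rho(G): G\in\mathcal{G}_{n,k}\}=\max\{\rho(K_s\vee(sK_1\cup K_{n-2s})): k\le s\le\lfloor\tfrac{n-1}{2}\rfloor\}.$$ Moreover (without the assumption $n\ge 2k+1$), up to isomorphism, $$\operatorname{SPEX}_{\rho}(n,C_n;\delta\ge k)\subseteq\{K_s\vee(sK_1\cup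 K_{n-2s}): k\le s\le\lfloor\tfrac{n-1}{2}\rfloor\}.$$ (ii) If $n\ge 2k+1$, then $$\max\{q(G): G\in\mathcal{G}_{n,k}\}=\max\{q(K_s\vee(sK_1\cup K_{n-2s})): k\le s\le\lfloor\tfrac{n-1}{2}\rfloor\}.$$ Moreover (without the assumption $n\ge 2k+1$), up to isomorphism, $$\operatorname{SPEX}_{q}(n,C_n;\delta\ge k)\subseteq\{K_s\vee(sK_1\cup K_{n-2s}): k\le s\le\lfloor\tfrac{n-1}{2}\rfloor\}.$$ (For $3\le n\le 2k$ the class $\mathcal{G}_{n,k}$ and the family on the right are both empty.) -/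

import Mathlib

namespace HamSpex

/-- The join `G ∨ H`: the disjoint union of `G` and `H` together with every edge between them. -/
def join {V W : Type} (G : SimpleGraph V) (H : SimpleGraph W) : SimpleGraph (V ⊕ W) :=
  (G ⊕g H) ⊔ completeBipartiteGraph V W

/-- The graph `K_s ∨ (s K_1 ∪ K_{n - 2s})`. It is used for `2 * s ≤ n` only, and then it has `n`
vertices. -/
def extremalGraph (n s : ℕ) : SimpleGraph (Fin s ⊕ (Fin s ⊕ Fin (n - 2 * s))) :=
  join (⊤ : SimpleGraph (Fin s))
    ((⊥ : SimpleGraph (Fin s)) ⊕g (⊤ : SimpleGraph (Fin (n - 2 * s))))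

/-- Real-valued graph parameters of finite simple graphs. -/
abbrev GraphParameter : Type 1 := (V : Type) → [Fintype V] → SimpleGraph V → ℝ

open Classical in
/-- The spectral radius of a graph: the largest modulus of an eigenvalue of the adjacency matrix.
The matrix is real symmetric, so that all its eigenvalues are real. -/
noncomputable def rho : GraphParameter := fun _ _ G =>
  (spectralRadius ℝ (G.adjMatrix ℝ)).toReal

open Classical in
/-- The signless Laplacian matrix `Q = A + D`. -/
noncomputable def signlessLaplacian {V : Type} [Fintype V] (G : SimpleGraph V) : Matrix V V ℝ :=
  G.adjMatrix ℝ + G.degMatrix ℝ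

open Classical in
/-- The signless Laplacian spectral radius of a graph: the largest eigenvalue of `Q = A + D`. -/
noncomputable def q : GraphParameter := fun _ _ G =>
  sSup (spectrum ℝ (signlessLaplacian G))

open Classical in
/-- The graphs on `n` vertices with minimum degree at least `k` that have no Hamilton cycle. -/
def nonHamiltonian (n k : ℕ) : Set (SimpleGraph (Fin n)) :=
  {G | k ≤ G.minDegree ∧ ¬ G.IsHamiltonian}

/-- `IsSpex P n k m`: the maximum of `P` over all non-Hamiltonian graphs on `n` vertices with
minimum degree at least `k` exists and equals `m`. -/
def IsSpex (P : GraphParameter) (n k : ℕ) (m : ℝ) : Prop :=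
  IsGreatest ((fun G : SimpleGraph (Fin n) => P (Fin n) G) '' nonHamiltonian n k) m

/-- The non-Hamiltonian graphs on `n` vertices with minimum degree at least `k` that attain the
maximum of `P` among all such graphs. -/
def SPEX (P : GraphParameter) (n k : ℕ) : Set (SimpleGraph (Fin n)) :=
  {G | G ∈ nonHamiltonian n k ∧ ∀ G' ∈ nonHamiltonian n k, P (Fin n) G' ≤ P (Fin n) G}

/-- `IsFamilyMax P n k m`: the maximum of `P (K_s ∨ (s K_1 ∪ K_{n - 2s}))` over all `s` with
`k ≤ s ≤ ⌊(n - 1) / 2⌋` exists and equals `m`. -/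
def IsFamilyMax (P : GraphParameter) (n k : ℕ) (m : ℝ) : Prop :=
  IsGreatest ((fun s : ℕ => P _ (extremalGraph n s)) '' Set.Icc k ((n - 1) / 2)) m

/-- The graphs on `n` vertices that are, up to isomorphism, of the form
`K_s ∨ (s K_1 ∪ K_{n - 2s})` with `k ≤ s ≤ ⌊(n - 1) / 2⌋`. -/
def extremalFamily (n k : ℕ) : Set (SimpleGraph (Fin n)) :=
  {G | ∃ s ∈ Set.Icc k ((n - 1) / 2), Nonempty (G ≃g extremalGraph n s)}

end HamSpex

namespace HamSpex
open Matrix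
section Spectral
variable {V : Type*} [Fintype V] [DecidableEq V] {A : Matrix V V ℝ}

theorem isGreatest_sSup_spectrum [Nonempty V] (hA : A.IsHermitian) :
    IsGreatest (spectrum ℝ A) (sSup (spectrum ℝ A)) := by
  rw [hA.spectrum_real_eq_range_eigenvalues]
  exact (Set.finite_range _).isCompact.isGreatest_sSup (Set.range_nonempty _)

theorem exists_eigenvector_of_mem_spectrum {μ : ℝ} (h : μ ∈ spectrum ℝ A) :
    ∃ x : V → ℝ, x ≠ 0 ∧ A *ᵥ x = μ • x := by
  rw [← Matrix.spectrum_toLin', ← Module.End.hasEigenvalue_iff_mem_spectrum] at h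
  obtain ⟨x, hx⟩ := h.exists_hasEigenvector
  exact ⟨x, hx.2, by simpa using hx.apply_eq_smul⟩

theorem posSemidef_sSup_spectrum_sub [Nonempty V] (hA : A.IsHermitian) :
    (sSup (spectrum ℝ A) • (1 : Matrix V V ℝ) - A).PosSemidef := by
  have hH : (sSup (spectrum ℝ A) • (1 : Matrix V V ℝ) - A).IsHermitian := by
    refine IsHermitian.sub ?_ hA
    simp [IsHermitian]
  rw [hH.posSemidef_iff_eigenvalues_nonneg]
  intro i
  have hi : hH.eigenvalues i ∈ spectrum ℝ (sSup (spectrum ℝ A) • (1 : Matrix V V ℝ) - A) := by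
    rw [hH.spectrum_real_eq_range_eigenvalues]
    exact ⟨i, rfl⟩
  obtain ⟨x, hx, hAx⟩ := exists_eigenvector_of_mem_spectrum hi
  have hmem : sSup (spectrum ℝ A) - hH.eigenvalues i ∈ spectrum ℝ A := by
    generalize hH.eigenvalues i = μ at hAx ⊢
    generalize sSup (spectrum ℝ A) = l at hAx ⊢
    rw [← Matrix.spectrum_toLin', ← Module.End.hasEigenvalue_iff_mem_spectrum]
    refine Module.End.hasEigenvalue_of_hasEigenvector (x := x) ⟨?_, hx⟩
    rw [Module.End.mem_eigenspace_iff, toLin'_apply, sub_smul, ← hAx, sub_mulVec, smul_mulVec,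
      one_mulVec, sub_sub_cancel]
  have := (isGreatest_sSup_spectrum hA).2 hmem
  simp only [Pi.zero_apply]
  linarith

theorem dotProduct_mulVec_le [Nonempty V] (hA : A.IsHermitian) (x : V → ℝ) :
    x ⬝ᵥ A *ᵥ x ≤ sSup (spectrum ℝ A) * (x ⬝ᵥ x) := by
  have := (posSemidef_sSup_spectrum_sub hA).dotProduct_mulVec_nonneg x
  simp only [star_trivial, sub_mulVec, smul_mulVec, one_mulVec, dotProduct_sub, dotProduct_smul,
    smul_eq_mul] at this
  linarith

theorem mulVec_eq_of_dotProduct_mulVec_eq [Nonempty V] (hA : A.IsHermitian) {x : V → ℝ}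
    (h : x ⬝ᵥ A *ᵥ x = sSup (spectrum ℝ A) * (x ⬝ᵥ x)) :
    A *ᵥ x = sSup (spectrum ℝ A) • x := by
  have := ((posSemidef_sSup_spectrum_sub hA).dotProduct_mulVec_zero_iff x).1 (by
    simp only [star_trivial, sub_mulVec, smul_mulVec, one_mulVec, dotProduct_sub, dotProduct_smul,
      smul_eq_mul, h, sub_self])
  rw [sub_mulVec, smul_mulVec, one_mulVec, sub_eq_zero] at this
  exact this.symm

omit [DecidableEq V] in
theorem dotProduct_abs_self (x : V → ℝ) : |x| ⬝ᵥ |x| = x ⬝ᵥ x := by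
  simp [dotProduct]

omit [DecidableEq V] in
theorem abs_dotProduct_mulVec_le (hA : ∀ i j, 0 ≤ A i j) (x : V → ℝ) :
    |x ⬝ᵥ A *ᵥ x| ≤ |x| ⬝ᵥ A *ᵥ |x| := by
  simp only [dotProduct, mulVec, Finset.mul_sum]
  refine (Finset.abs_sum_le_sum_abs _ _).trans (Finset.sum_le_sum fun i _ => ?_)
  refine (Finset.abs_sum_le_sum_abs _ _).trans (Finset.sum_le_sum fun j _ => ?_)
  simp [abs_mul, abs_of_nonneg (hA i j)]

theorem exists_nonneg_maximizer [Nonempty V] (hA : A.IsHermitian) (h0 : ∀ i j, 0 ≤ A i j) :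
    ∃ x : V → ℝ, 0 ≤ x ∧ x ≠ 0 ∧ x ⬝ᵥ A *ᵥ x = sSup (spectrum ℝ A) * (x ⬝ᵥ x) := by
  obtain ⟨x, hx, hAx⟩ := exists_eigenvector_of_mem_spectrum (isGreatest_sSup_spectrum hA).1
  refine ⟨|x|, abs_nonneg x, by simpa using hx, (dotProduct_mulVec_le hA _).antisymm ?_⟩
  refine le_trans ?_ ((le_abs_self _).trans (abs_dotProduct_mulVec_le h0 x))
  rw [hAx, dotProduct_abs_self, dotProduct_smul, smul_eq_mul]

theorem toReal_spectralRadius [Nonempty V] (hA : A.IsHermitian) (h0 : ∀ i j, 0 ≤ A i j) :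
    (spectralRadius ℝ A).toReal = sSup (spectrum ℝ A) := by
  have key : ∀ μ ∈ spectrum ℝ A, |μ| ≤ sSup (spectrum ℝ A) := by
    intro μ hμ
    obtain ⟨x, hx, hAx⟩ := exists_eigenvector_of_mem_spectrum hμ
    have hpos : 0 < x ⬝ᵥ x := by
      simpa using dotProduct_star_self_pos_iff.2 hx
    have h1 := (abs_dotProduct_mulVec_le h0 x).trans (dotProduct_mulVec_le hA |x|)
    rw [hAx, dotProduct_abs_self, dotProduct_smul, smul_eq_mul, abs_mul, abs_of_pos hpos] at h1
    exact le_of_mul_le_mul_right h1 hpos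
  have hmem := (isGreatest_sSup_spectrum hA).1
  have hnn : 0 ≤ sSup (spectrum ℝ A) := (abs_nonneg _).trans (key _ hmem)
  have : spectralRadius ℝ A = ‖sSup (spectrum ℝ A)‖₊ := by
    refine le_antisymm (iSup₂_le fun μ hμ => ?_) ?_
    · rw [ENNReal.coe_le_coe, ← NNReal.coe_le_coe, coe_nnnorm, coe_nnnorm, Real.norm_eq_abs,
        Real.norm_of_nonneg hnn]
      exact key μ hμ
    · exact le_iSup₂ (f := fun μ (_ : μ ∈ spectrum ℝ A) => (‖μ‖₊ : ENNReal)) _ hmem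
  rw [this, ENNReal.coe_toReal, coe_nnnorm, Real.norm_of_nonneg hnn]

end Spectral
end HamSpex

namespace HamSpex
section Hamilton
open SimpleGraph
variable {V : Type*} {G : SimpleGraph V}

/-- The sequence `f 0, …, f n = f 0` runs once through the vertices of a closed walk of length `n`,
with no repetition among `f 0, …, f (n - 1)`. -/
structure IsCyclicSequence (G : SimpleGraph V) (n : ℕ) (f : ℕ → V) : Prop where
  injOn : Set.InjOn f (Set.Iio n)
  closed : f n = f 0
  adj : ∀ i < n, G.Adj (f i) (f (i + 1))

theorem IsCyclicSequence.injOn_Icc {n : ℕ} {f : ℕ → V} (hf : IsCyclicSequence G n f) :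
    Set.InjOn f (Set.Icc 1 n) := by
  intro i hi j hj hij
  obtain ⟨hi1, hin⟩ := hi
  obtain ⟨hj1, hjn⟩ := hj
  rcases hin.eq_or_lt with rfl | hin <;> rcases hjn.eq_or_lt with rfl | hjn
  · rfl
  · rw [hf.closed] at hij
    have := hf.injOn (Set.mem_Iio.2 (by omega)) (Set.mem_Iio.2 hjn) hij
    omega
  · rw [hf.closed] at hij
    have := hf.injOn (Set.mem_Iio.2 hin) (Set.mem_Iio.2 (by omega)) hij
    omega
  · exact hf.injOn hin hjn hij

theorem IsCyclicSequence.reverse {n : ℕ} {f : ℕ → V} (hf : IsCyclicSequence G n f) :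
    IsCyclicSequence G n fun i => f (n - i) where
  injOn i hi j hj hij := by
    simp only [Set.mem_Iio] at hi hj
    have := hf.injOn_Icc (Set.mem_Icc.2 (by omega)) (Set.mem_Icc.2 (by omega)) hij
    omega
  closed := by simpa using hf.closed.symm
  adj i hi := by
    have := (hf.adj (n - (i + 1)) (by omega)).symm
    rwa [show n - (i + 1) + 1 = n - i by omega] at this

theorem exists_walk_of_sequence {n : ℕ} {f : ℕ → V} (hf : ∀ i < n, G.Adj (f i) (f (i + 1))) :
    ∃ p : G.Walk (f 0) (f n), p.length = n ∧ ∀ i ≤ n, p.getVert i = f i := by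
  induction n generalizing f with
  | zero => exact ⟨.nil, rfl, fun i hi => by simp [Nat.le_zero.1 hi]⟩
  | succ n ih =>
    obtain ⟨p, hp, hv⟩ := ih (f := fun i => f (i + 1)) fun i hi => hf (i + 1) (by omega)
    refine ⟨.cons (hf 0 (by omega)) p, by simp [hp], fun i hi => ?_⟩
    cases i with
    | zero => simp
    | succ i => simpa using hv i (by omega)

theorem exists_isCyclicSequence_apply_zero [Fintype V] [DecidableEq V]
    (hV : 3 ≤ Fintype.card V) (hG : G.IsHamiltonian) (v : V) :
    ∃ f : ℕ → V, f 0 = v ∧ IsCyclicSequence G (Fintype.card V) f := by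
  have : Nontrivial V := Fintype.one_lt_card_iff_nontrivial.1 (by omega)
  obtain ⟨p, hp⟩ := hG.exists_isHamiltonianCycle v
  refine ⟨p.getVert, by simp, fun i hi j hj hij => ?_, ?_, fun i hi => ?_⟩
  · rw [← hp.length_eq] at hi hj
    simp only [Set.mem_Iio] at hi hj
    exact hp.isCycle.getVert_injOn' (by simp only [Set.mem_ofPred_eq]; omega)
      (by simp only [Set.mem_ofPred_eq]; omega) hij
  · rw [← hp.length_eq, Walk.getVert_length, Walk.getVert_zero]
  · exact p.adj_getVert_succ (by rwa [hp.length_eq])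

theorem isHamiltonian_iff_exists_isCyclicSequence [Fintype V] [DecidableEq V]
    (hV : 3 ≤ Fintype.card V) :
    G.IsHamiltonian ↔ ∃ f : ℕ → V, IsCyclicSequence G (Fintype.card V) f := by
  constructor
  · intro h
    have : Nonempty V := Fintype.card_pos_iff.1 (by omega)
    obtain ⟨f, -, hf⟩ := exists_isCyclicSequence_apply_zero hV h (Classical.arbitrary V)
    exact ⟨f, hf⟩
  · rintro ⟨f, hf⟩ -
    have := exists_walk_of_sequence hf.adj
    rw [hf.closed] at this
    obtain ⟨p, hp, hv⟩ := this
    have hnil : ¬ p.Nil := by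
      rw [← Walk.length_eq_zero_iff]
      omega
    have htl := p.length_tail_add_one hnil
    refine ⟨f 0, p, Walk.isHamiltonianCycle_iff_isCycle_and_length_eq.2
      ⟨Walk.isCycle_iff_isPath_tail_and_le_length.2 ⟨?_, by omega⟩, hp⟩⟩
    rw [← Walk.IsPath.getVert_injOn_iff]
    intro i hi j hj hij
    simp only [Set.mem_ofPred_eq] at hi hj
    rw [Walk.getVert_tail, Walk.getVert_tail, hv _ (by omega), hv _ (by omega)] at hij
    have := hf.injOn_Icc (Set.mem_Icc.2 (by omega)) (Set.mem_Icc.2 (by omega)) hij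
    omega

variable [Fintype V]

theorem exists_lt_eq_of_injOn {f : ℕ → V} (hf : Set.InjOn f (Set.Iio (Fintype.card V))) (v : V) :
    ∃ i < Fintype.card V, f i = v := by
  have hinj : Function.Injective fun i : Fin (Fintype.card V) => f i := fun i j hij =>
    Fin.ext (hf i.2 j.2 hij)
  obtain ⟨i, hi⟩ := ((Fintype.bijective_iff_injective_and_card _).2 ⟨hinj, by simp⟩).2 v
  exact ⟨i, i.2, hi⟩

/-- Two ends of a Hamilton path with large degree sum close up to a Hamilton cycle. -/
theorem exists_isCyclicSequence_of_path [DecidableRel G.Adj] {f : ℕ → V}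
    (hV : 3 ≤ Fintype.card V) (hinj : Set.InjOn f (Set.Iio (Fintype.card V)))
    (hadj : ∀ i, i + 1 < Fintype.card V → G.Adj (f i) (f (i + 1)))
    (hdeg : Fintype.card V ≤ G.degree (f 0) + G.degree (f (Fintype.card V - 1))) :
    ∃ g : ℕ → V, IsCyclicSequence G (Fintype.card V) g := by
  classical
  generalize hn : Fintype.card V = n at *
  let S := (Finset.range (n - 1)).filter fun i => G.Adj (f 0) (f (i + 1))
  let T := (Finset.range (n - 1)).filter fun i => G.Adj (f (n - 1)) (f i)
  have hS : G.degree (f 0) ≤ S.card := by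
    rw [← card_neighborFinset_eq_degree]
    refine (Finset.card_le_card ?_).trans (Finset.card_image_le (f := fun i => f (i + 1)))
    intro v hv
    rw [mem_neighborFinset] at hv
    obtain ⟨i, hi, rfl⟩ := exists_lt_eq_of_injOn (hn ▸ hinj) v
    have hi0 : i ≠ 0 := by rintro rfl; exact hv.ne rfl
    obtain ⟨j, rfl⟩ := Nat.exists_eq_succ_of_ne_zero hi0
    exact Finset.mem_image.2 ⟨j, by simp only [S, Finset.mem_filter, Finset.mem_range]; exact
      ⟨by omega, hv⟩, rfl⟩
  have hT : G.degree (f (n - 1)) ≤ T.card := by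
    rw [← card_neighborFinset_eq_degree]
    refine (Finset.card_le_card ?_).trans (Finset.card_image_le (f := f))
    intro v hv
    rw [mem_neighborFinset] at hv
    obtain ⟨i, hi, rfl⟩ := exists_lt_eq_of_injOn (hn ▸ hinj) v
    have hi0 : i ≠ n - 1 := by rintro rfl; exact hv.ne rfl
    exact Finset.mem_image.2 ⟨i, by simp only [T, Finset.mem_filter, Finset.mem_range]; exact
      ⟨by omega, hv⟩, rfl⟩
  have hST : ¬ Disjoint S T := by
    intro h
    have h1 := Finset.card_le_card (Finset.union_subset (Finset.filter_subset _ _)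
      (Finset.filter_subset _ _) : S ∪ T ⊆ Finset.range (n - 1))
    rw [Finset.card_union_of_disjoint h, Finset.card_range] at h1
    omega
  obtain ⟨k, hkS, hkT⟩ := Finset.not_disjoint_iff.1 hST
  simp only [S, T, Finset.mem_filter, Finset.mem_range] at hkS hkT
  obtain ⟨hk, hk1⟩ := hkS
  have hk2 := hkT.2
  refine ⟨fun j => if j ≤ k then f j else if j < n then f (n + k - j) else f 0, ?_, ?_, ?_⟩
  · intro i hi j hj hij
    simp only [Set.mem_Iio] at hi hj
    simp only [hi, hj, if_true] at hij
    split_ifs at hij <;>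
    · have := hinj (Set.mem_Iio.2 (by omega)) (Set.mem_Iio.2 (by omega)) hij
      omega
  · simp [show ¬ n ≤ k by omega]
  · intro i hi
    rcases lt_trichotomy i k with h | rfl | h
    · rw [if_pos (by omega), if_pos (by omega)]
      exact hadj i (by omega)
    · rw [if_pos le_rfl, if_neg (by omega), if_pos (by omega), show n + i - (i + 1) = n - 1 by omega]
      exact hk2.symm
    · rw [if_neg (by omega), if_pos (by omega), if_neg (by omega)]
      split_ifs with h2
      · have := (hadj (n + k - (i + 1)) (by omega)).symm
        rwa [show n + k - (i + 1) + 1 = n + k - i by omega] at this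
      · rw [show n + k - i = k + 1 by omega]
        exact hk1.symm

/-- The Bondy–Chvátal closure step. -/
theorem degree_add_degree_lt_of_not_isHamiltonian [DecidableEq V] [DecidableRel G.Adj] {u v : V}
    (hV : 3 ≤ Fintype.card V) (hG : ¬ G.IsHamiltonian) (hH : (G ⊔ edge u v).IsHamiltonian) :
    G.degree u + G.degree v < Fintype.card V := by
  by_contra! hdeg
  rw [isHamiltonian_iff_exists_isCyclicSequence hV] at hG
  have key : ∀ f : ℕ → V, f 0 = u → IsCyclicSequence (G ⊔ edge u v) (Fintype.card V) f →
      f 1 ≠ v := by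
    intro f h0 hf h1
    have hadj : ∀ i, i + 1 < Fintype.card V → G.Adj (f (i + 1)) (f (i + 1 + 1)) := by
      intro i hi
      have h := hf.adj (i + 1) hi
      rw [sup_adj, edge_adj] at h
      refine h.resolve_right ?_
      rintro ⟨⟨h2, -⟩ | ⟨h2, h3⟩, -⟩
      · rw [← h0, ← hf.closed] at h2
        have := hf.injOn_Icc (Set.mem_Icc.2 (by omega)) (Set.mem_Icc.2 (by omega)) h2
        omega
      · rw [← h1] at h2
        rw [← h0, ← hf.closed] at h3
        have h4 := hf.injOn_Icc (Set.mem_Icc.2 (by omega)) (Set.mem_Icc.2 (by omega)) h2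
        have h5 := hf.injOn_Icc (Set.mem_Icc.2 (by omega)) (Set.mem_Icc.2 (by omega)) h3
        omega
    refine hG (exists_isCyclicSequence_of_path (f := fun i => f (i + 1)) hV ?_ hadj ?_)
    · intro i hi j hj hij
      simp only [Set.mem_Iio] at hi hj
      have := hf.injOn_Icc (Set.mem_Icc.2 (by omega)) (Set.mem_Icc.2 (by omega)) hij
      omega
    · rw [Nat.sub_add_cancel (by omega), hf.closed, h0, h1]
      omega
  obtain ⟨f, h0, hf⟩ := exists_isCyclicSequence_apply_zero hV hH u
  have h1 := key f h0 hf
  have h2 := key _ (by simp [hf.closed, h0]) hf.reverse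
  refine hG ⟨f, hf.injOn, hf.closed, fun i hi => ?_⟩
  have h := hf.adj i hi
  rw [sup_adj, edge_adj] at h
  refine h.resolve_right ?_
  rintro ⟨⟨h3, h4⟩ | ⟨h3, h4⟩, -⟩
  · rw [← h0] at h3
    have := hf.injOn (Set.mem_Iio.2 hi) (Set.mem_Iio.2 (by omega)) h3
    subst this
    exact h1 h4
  · rw [← h0, ← hf.closed] at h4
    have := hf.injOn_Icc (Set.mem_Icc.2 (by omega)) (Set.mem_Icc.2 (by omega)) h4
    rw [← this, Nat.add_sub_cancel] at h2
    exact h2 h3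

theorem isHamiltonian_top [DecidableEq V] (hV : 3 ≤ Fintype.card V) :
    (⊤ : SimpleGraph V).IsHamiltonian := by
  have e := (Fintype.equivFin V).symm
  have h0 : 0 < Fintype.card V := by omega
  rw [isHamiltonian_iff_exists_isCyclicSequence hV]
  refine ⟨fun i => e ⟨i % Fintype.card V, Nat.mod_lt _ h0⟩, fun i hi j hj hij => ?_, by simp,
    fun i hi => ?_⟩
  · simpa [Nat.mod_eq_of_lt (Set.mem_Iio.1 hi), Nat.mod_eq_of_lt (Set.mem_Iio.1 hj)] using hij
  · simp only [top_adj, ne_eq, EmbeddingLike.apply_eq_iff_eq, Fin.mk.injEq]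
    rw [Nat.mod_eq_of_lt hi]
    rcases (Nat.succ_le_of_lt hi).eq_or_lt with h | h
    · rw [← h, Nat.mod_self]
      omega
    · rw [Nat.mod_eq_of_lt h]
      omega

open Classical in
/-- Chvátal's degree condition: a non-Hamiltonian graph on `n ≥ 3` vertices has, for some
`s < n / 2`, at least `s` vertices of degree at most `s` and at least `n - s` vertices of degree
at most `n - 1 - s`. -/
theorem exists_card_filter_degree_le [DecidableEq V] (hV : 3 ≤ Fintype.card V)
    (hG : ¬ G.IsHamiltonian) :
    ∃ s, G.minDegree ≤ s ∧ 2 * s + 1 ≤ Fintype.card V ∧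
      s ≤ (Finset.univ.filter fun v => G.degree v ≤ s).card ∧
      Fintype.card V - s ≤
        (Finset.univ.filter fun v => G.degree v ≤ Fintype.card V - 1 - s).card := by
  obtain ⟨H, hGH, hH⟩ := (Set.toFinite {H : SimpleGraph V | ¬ H.IsHamiltonian}).exists_le_maximal hG
  have hnt : H ≠ ⊤ := fun h => hH.prop (h ▸ isHamiltonian_top hV)
  have hclosed : ∀ u v, u ≠ v → ¬ H.Adj u v → H.degree u + H.degree v < Fintype.card V := by
    intro u v huv hadj
    refine degree_add_degree_lt_of_not_isHamiltonian hV hH.prop ?_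
    by_contra h
    exact hadj (hH.2 h le_sup_left (by simp [edge_adj, huv]))
  obtain ⟨a, b, hab, habadj⟩ := ne_top_iff_exists_not_adj.1 hnt
  obtain ⟨⟨u, v⟩, huv, hmax⟩ := (Finset.univ.filter fun p : V × V => p.1 ≠ p.2 ∧ ¬ H.Adj p.1 p.2)
    |>.exists_max_image (fun p => H.degree p.1 + H.degree p.2) ⟨(a, b), by simp [hab, habadj]⟩
  simp only [Finset.mem_filter, Finset.mem_univ, true_and, Prod.forall, and_imp] at huv hmax
  wlog hle : H.degree u ≤ H.degree v generalizing u v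
  · exact this v u ⟨huv.1.symm, fun h => huv.2 h.symm⟩ (by simpa [add_comm] using hmax) (by omega)
  have hdeg : ∀ w, G.degree w ≤ H.degree w := fun w => degree_le_of_le hGH
  have hsum := hclosed u v huv.1 huv.2
  refine ⟨H.degree u, (G.minDegree_le_degree u).trans (hdeg u), by omega, ?_, ?_⟩
  · refine le_trans ?_ (Finset.card_le_card (s := Hᶜ.neighborFinset v) ?_)
    · rw [card_neighborFinset_eq_degree, degree_compl]
      omega
    · intro w hw
      rw [mem_neighborFinset, compl_adj] at hw
      have := hmax w v hw.1.symm fun h => hw.2 h.symm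
      have := hdeg w
      simp only [Finset.mem_filter, Finset.mem_univ, true_and]
      omega
  · refine le_trans ?_ (Finset.card_le_card (s := insert u (Hᶜ.neighborFinset u)) ?_)
    · rw [Finset.card_insert_of_notMem (by simp), card_neighborFinset_eq_degree, degree_compl]
      omega
    · intro w hw
      have := hdeg w
      simp only [Finset.mem_filter, Finset.mem_univ, true_and]
      rw [Finset.mem_insert, mem_neighborFinset, compl_adj] at hw
      rcases hw with rfl | hw
      · omega
      · have := hmax u w hw.1 hw.2
        omega

end Hamilton
end HamSpex

namespace HamSpex
open SimpleGraph
section Threshold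

/-- The graph `K_s ∨ (s K_1 ∪ K_{n - 2s})` on `Fin n`: the first `s` vertices are adjacent to all
others, the last `s` vertices to no others than these, and the remaining ones form a clique. -/
def thresholdGraph (n s : ℕ) : SimpleGraph (Fin n) where
  Adj i j := i ≠ j ∧ (i.val < s ∨ j.val < s ∨ (i.val < n - s ∧ j.val < n - s))
  symm := ⟨fun i j h => ⟨h.1.symm, by tauto⟩⟩
  loopless := ⟨fun i h => h.1 rfl⟩

instance (n s : ℕ) : DecidableRel (thresholdGraph n s).Adj := fun i j =>
  inferInstanceAs (Decidable (i ≠ j ∧ (i.val < s ∨ j.val < s ∨ (i.val < n - s ∧ j.val < n - s))))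

theorem thresholdGraph_adj {n s : ℕ} {i j : Fin n} : (thresholdGraph n s).Adj i j ↔
    i ≠ j ∧ (i.val < s ∨ j.val < s ∨ (i.val < n - s ∧ j.val < n - s)) := Iff.rfl

theorem nonempty_iso_extremalGraph {n s : ℕ} (h : 2 * s ≤ n) :
    Nonempty (thresholdGraph n s ≃g extremalGraph n s) := by
  let f : Fin s ⊕ (Fin s ⊕ Fin (n - 2 * s)) → Fin n :=
    Sum.elim (fun a => ⟨a, by omega⟩)
      (Sum.elim (fun b => ⟨n - s + b, by omega⟩) fun c => ⟨s + c, by omega⟩)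
  have hf : Function.Bijective f := by
    refine (Fintype.bijective_iff_injective_and_card f).2 ⟨?_, by simp; omega⟩
    rintro (a | a | a) (b | b | b) hab <;>
      simp only [f, Sum.elim_inl, Sum.elim_inr, Fin.mk.injEq] at hab <;>
      first
      | (exfalso; omega)
      | (congr; apply Fin.ext; omega)
  refine ⟨(RelIso.mk (Equiv.ofBijective f hf) ?_).symm⟩
  rintro (a | a | a) (b | b | b) <;>
    simp [extremalGraph, join, completeBipartiteGraph, thresholdGraph_adj, f, Fin.ext_iff] <;> omega

theorem card_filter_val_lt {n m : ℕ} (h : m ≤ n) :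
    (Finset.univ.filter fun i : Fin n => i.val < m).card = m := by
  rw [Fin.card_filter_val_lt]
  omega

/-- The degree of the vertex `i` of `thresholdGraph n s`. -/
def thresholdDegree (n s i : ℕ) : ℕ := if i < s then n - 1 else if i < n - s then n - 1 - s else s

theorem min_thresholdDegree_le_card {n s b : ℕ} (hs : 2 * s + 1 ≤ n) (hb : b ≤ n) {i : Fin n}
    (hi : i.val < b) :
    min (thresholdDegree n s i) (b - 1) ≤
      (Finset.univ.filter fun j : Fin n => j.val < b ∧ (thresholdGraph n s).Adj i j).card := by
  have key : ∀ m ≤ n, i.val < m → (∀ j : Fin n, j ≠ i → j.val < m →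
      j.val < b ∧ (thresholdGraph n s).Adj i j) → m - 1 ≤
      (Finset.univ.filter fun j : Fin n => j.val < b ∧ (thresholdGraph n s).Adj i j).card := by
    intro m hm him h
    rw [← card_filter_val_lt hm, ← Finset.card_erase_of_mem (a := i) (by simpa using him)]
    refine Finset.card_le_card fun j hj => ?_
    simp only [Finset.mem_erase, Finset.mem_filter, Finset.mem_univ, true_and] at hj ⊢
    exact h j hj.1 hj.2
  unfold thresholdDegree
  split_ifs with h1 h2
  · refine (min_le_right _ _).trans (key b hb hi fun j hj hjb => ⟨hjb, hj.symm, Or.inl h1⟩)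
  · have := key (min b (n - s)) (by omega) (by omega) fun j hj hjb =>
      ⟨by omega, hj.symm, Or.inr (Or.inr ⟨h2, by omega⟩)⟩
    omega
  · refine (min_le_left _ _).trans ?_
    conv_lhs => rw [← card_filter_val_lt (n := n) (m := s) (by omega)]
    refine Finset.card_le_card fun j hj => ?_
    simp only [Finset.mem_filter, Finset.mem_univ, true_and] at hj ⊢
    exact ⟨by omega, fun h => by subst h; omega, Or.inr (Or.inl hj)⟩

theorem thresholdDegree_le_degree {n s : ℕ} (hs : 2 * s + 1 ≤ n) (i : Fin n) :
    thresholdDegree n s i ≤ (thresholdGraph n s).degree i := by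
  have h := min_thresholdDegree_le_card hs le_rfl i.2
  have h1 : thresholdDegree n s i ≤ n - 1 := by
    unfold thresholdDegree
    split_ifs <;> omega
  rw [min_eq_left h1] at h
  refine h.trans_eq ?_
  rw [← card_neighborFinset_eq_degree]
  congr 1
  ext j
  simp

theorem not_isHamiltonian_thresholdGraph {n s : ℕ} (hn : 3 ≤ n) (hs1 : 1 ≤ s) (hs : 2 * s + 1 ≤ n) :
    ¬ (thresholdGraph n s).IsHamiltonian := by
  intro h
  obtain ⟨f, h0, hf⟩ := exists_isCyclicSequence_apply_zero (by simpa) h ⟨0, by omega⟩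
  have hsurj := exists_lt_eq_of_injOn hf.injOn
  simp only [Fintype.card_fin] at hf hsurj
  have hlow : ∀ i < n, n - s ≤ (f (i + 1)).val → (f i).val < s := by
    intro i hi h
    have := (hf.adj i hi).2
    omega
  let A := (Finset.range n).filter fun i => n - s ≤ (f (i + 1)).val
  let B := (Finset.range n).filter fun i => (f i).val < s
  have hAB : A ⊆ B := by
    intro i hi
    simp only [A, B, Finset.mem_filter, Finset.mem_range] at hi ⊢
    exact ⟨hi.1, hlow i hi.1 hi.2⟩
  have hB : B.card ≤ s := by
    refine le_of_le_of_eq ?_ (card_filter_val_lt (n := n) (m := s) (by omega))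
    refine Finset.card_le_card_of_injOn f (fun i hi => ?_) fun i hi j hj hij => ?_
    · simp only [B, Finset.coe_filter, Finset.mem_range, Set.mem_ofPred_eq] at hi
      simpa using hi.2
    · simp only [B, Finset.coe_filter, Finset.mem_range, Set.mem_ofPred_eq] at hi hj
      exact hf.injOn hi.1 hj.1 hij
  have hA : s ≤ A.card := by
    have hc := Finset.card_filter_add_card_filter_not (s := (Finset.univ : Finset (Fin n)))
      fun i => i.val < n - s
    rw [card_filter_val_lt (by omega), Finset.card_univ, Fintype.card_fin] at hc
    refine le_trans ?_ ((Finset.card_le_card (s := Finset.univ.filter fun i : Fin n =>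
      ¬ i.val < n - s) (t := A.image fun i => f (i + 1)) fun v hv => ?_).trans
      Finset.card_image_le)
    · omega
    simp only [Finset.mem_filter, Finset.mem_univ, true_and, not_lt] at hv
    obtain ⟨i, hi, rfl⟩ := hsurj v
    have hi0 : i ≠ 0 := by
      rintro rfl
      rw [h0] at hv
      have : n - s ≤ 0 := hv
      omega
    obtain ⟨j, rfl⟩ := Nat.exists_eq_succ_of_ne_zero hi0
    refine Finset.mem_image.2 ⟨j, ?_, rfl⟩
    simp only [A, Finset.mem_filter, Finset.mem_range]
    exact ⟨by omega, hv⟩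
  have hEq : A = B := Finset.eq_of_subset_of_card_le hAB (hB.trans hA)
  have hall : ∀ i < n, (f i).val < s ∨ n - s ≤ (f i).val := by
    intro i
    induction i with
    | zero => intro _; rw [h0]; exact Or.inl hs1
    | succ i ih =>
      intro hi
      rcases ih (by omega) with h | h
      · have : i ∈ A := by
          rw [hEq]
          simp only [B, Finset.mem_filter, Finset.mem_range]
          exact ⟨by omega, h⟩
        simp only [A, Finset.mem_filter] at this
        exact Or.inr this.2
      · have := (hf.adj i (by omega)).2
        omega
  obtain ⟨i, hi, hfi⟩ := hsurj ⟨s, by omega⟩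
  have := hall i hi
  rw [hfi] at this
  simp only at this
  omega

end Threshold
end HamSpex

namespace HamSpex
open SimpleGraph Matrix
section Comparison

theorem sum_mul_nonneg_of_prefix {n : ℕ} {c y : Fin n → ℝ} (hy : Antitone y) (hy0 : 0 ≤ y)
    (hc : ∀ a ≤ n, 0 ≤ ∑ i : Fin n with i.val < a, c i) : 0 ≤ ∑ i, c i * y i := by
  let Y : ℕ → ℝ := fun i => if h : i < n then y ⟨i, h⟩ else 0
  let C : ℕ → ℝ := fun i => if h : i < n then c ⟨i, h⟩ else 0
  have hY0 : ∀ i, 0 ≤ Y i := by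
    intro i
    simp only [Y]
    split_ifs
    exacts [hy0 _, le_rfl]
  have hYa : ∀ i, Y (i + 1) ≤ Y i := by
    intro i
    by_cases h : i + 1 < n
    · simp only [Y, h, show i < n by omega, dif_pos]
      exact hy (Fin.mk_le_mk.2 (by omega))
    · simp only [Y, h, dif_neg, not_false_eq_true]
      exact hY0 i
  have hC : ∀ a ≤ n, ∑ i ∈ Finset.range a, C i = ∑ i : Fin n with i.val < a, c i := by
    intro a ha
    have h1 : ∀ i : Fin n, c i = C i := fun i => by simp [C]
    simp only [h1]
    rw [Finset.sum_filter, Fin.sum_univ_eq_sum_range (fun i => if i < a then C i else 0) n,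
      ← Finset.sum_filter]
    congr 1
    ext i
    simp only [Finset.mem_range, Finset.mem_filter]
    omega
  have hprefix : ∀ m ≤ n, (∑ i ∈ Finset.range m, C i) * Y m ≤ ∑ i ∈ Finset.range m, C i * Y i := by
    intro m
    induction m with
    | zero => simp
    | succ m ih =>
      intro hm
      have h1 := ih (by omega)
      have h2 : 0 ≤ ∑ i ∈ Finset.range (m + 1), C i := by
        rw [hC _ hm]
        exact hc _ hm
      have h3 := mul_le_mul_of_nonneg_left (hYa m) h2
      rw [Finset.sum_range_succ] at h3 ⊢
      rw [Finset.sum_range_succ]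
      nlinarith
  have h1 := hprefix n le_rfl
  have h2 : ∑ i ∈ Finset.range n, C i * Y i = ∑ i, c i * y i := by
    rw [← Fin.sum_univ_eq_sum_range (fun i => C i * Y i) n]
    simp [C, Y]
  have h3 : Y n = 0 := by simp [Y]
  rw [h2, h3, mul_zero] at h1
  exact h1

/-- The values of a monotone function at the degrees are dominated, summed over any `a` vertices,
by its values at the degrees of the threshold graph. -/
theorem sum_le_sum_thresholdDegree {n s : ℕ} (hs : 2 * s + 1 ≤ n) {d : Fin n → ℕ}
    (h1 : s ≤ (Finset.univ.filter fun v => d v ≤ s).card)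
    (h2 : n - s ≤ (Finset.univ.filter fun v => d v ≤ n - 1 - s).card)
    (hd : ∀ i, d i ≤ n - 1) {f : ℕ → ℕ} (hf : Monotone f) {a : ℕ} (ha : a ≤ n) :
    ∑ i : Fin n with i.val < a, f (d i) ≤ ∑ i : Fin n with i.val < a, f (thresholdDegree n s i) := by
  obtain ⟨q, hq⟩ := Nat.exists_eq_add_of_le (hf (show s ≤ n - 1 - s by omega))
  obtain ⟨p, hp⟩ := Nat.exists_eq_add_of_le (hf (show n - 1 - s ≤ n - 1 by omega))
  have hcount : ∀ m t, m ≤ n → m ≤ (Finset.univ.filter fun v => d v ≤ t).card →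
      ((Finset.univ.filter fun i : Fin n => i.val < a).filter fun i => t < d i).card ≤
      ((Finset.univ.filter fun i : Fin n => i.val < a).filter fun i => i.val < n - m).card := by
    intro m t hm h
    have e : ((Finset.univ.filter fun i : Fin n => i.val < a).filter fun i => i.val < n - m).card =
        min a (n - m) := by
      rw [Finset.filter_filter, ← card_filter_val_lt (n := n) (m := min a (n - m)) (by omega)]
      congr 1
      ext i
      simp
    rw [e]
    refine le_min ((Finset.card_filter_le _ _).trans_eq (card_filter_val_lt ha)) ?_
    have hc := Finset.card_filter_add_card_filter_not (s := (Finset.univ : Finset (Fin n)))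
      fun i => d i ≤ t
    rw [Finset.card_univ, Fintype.card_fin] at hc
    refine le_trans (Finset.card_le_card (t := Finset.univ.filter fun i => ¬ d i ≤ t) ?_) (by omega)
    intro i hi
    simp only [Finset.mem_filter, Finset.mem_univ, true_and] at hi ⊢
    omega
  have c1 := hcount s s (by omega) h1
  have c2 := hcount (n - s) (n - 1 - s) (by omega) h2
  calc ∑ i : Fin n with i.val < a, f (d i)
      ≤ ∑ i : Fin n with i.val < a,
          (f s + (if s < d i then q else 0) + (if n - 1 - s < d i then p else 0)) := by
        refine Finset.sum_le_sum fun i _ => ?_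
        split_ifs with h3 h4 h4
        · have := hf (hd i); omega
        · have := hf (not_lt.1 h4); omega
        · omega
        · have := hf (not_lt.1 h3); omega
    _ ≤ ∑ i : Fin n with i.val < a,
          (f s + (if i.val < n - s then q else 0) + (if i.val < n - (n - s) then p else 0)) := by
        simp only [Finset.sum_add_distrib, ← Finset.sum_filter, Finset.sum_const, smul_eq_mul]
        gcongr
    _ = ∑ i : Fin n with i.val < a, f (thresholdDegree n s i) := by
        refine Finset.sum_congr rfl fun i _ => ?_
        unfold thresholdDegree
        split_ifs <;> omega

open Classical in
/-- The matrix `A + c D` of a graph. -/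
noncomputable def weightedMatrix {V : Type} [Fintype V] (c : ℝ) (G : SimpleGraph V) :
    Matrix V V ℝ :=
  G.adjMatrix ℝ + c • G.degMatrix ℝ

open Classical in
theorem weightedMatrix_mulVec {V : Type} [Fintype V] (c : ℝ) (G : SimpleGraph V) (x : V → ℝ)
    (i : V) : (weightedMatrix c G *ᵥ x) i = ∑ j, if G.Adj i j then x j + c * x i else 0 := by
  rw [weightedMatrix, add_mulVec, smul_mulVec, Pi.add_apply, Pi.smul_apply, adjMatrix_mulVec_apply,
    degMatrix_mulVec_apply, ← Finset.sum_filter, Finset.sum_add_distrib, Finset.sum_const,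
    ← neighborFinset_eq_filter, card_neighborFinset_eq_degree]
  simp
  ring

open Classical in
theorem dotProduct_weightedMatrix_mulVec {V : Type} [Fintype V] (c : ℝ) (G : SimpleGraph V)
    (x : V → ℝ) : x ⬝ᵥ weightedMatrix c G *ᵥ x =
      ∑ i, (∑ j, (if G.Adj i j then 1 else 0) * x j) * x i + c * ∑ i, G.degree i * x i ^ 2 := by
  rw [weightedMatrix, add_mulVec, smul_mulVec, dotProduct_add, dotProduct_smul, smul_eq_mul]
  congr 1
  · simp [dotProduct, mulVec, mul_comm]
  · congr 1
    simp [dotProduct, degMatrix_mulVec_apply]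
    refine Finset.sum_congr rfl fun i _ => by ring

open Classical in
/-- The quadratic form of `A + c D` at a non-negative non-increasing vector is largest for the
threshold graph. -/
theorem dotProduct_weightedMatrix_le {n s : ℕ} (hs : 2 * s + 1 ≤ n) {G : SimpleGraph (Fin n)}
    (h1 : s ≤ (Finset.univ.filter fun v => G.degree v ≤ s).card)
    (h2 : n - s ≤ (Finset.univ.filter fun v => G.degree v ≤ n - 1 - s).card) {c : ℝ} (hc : 0 ≤ c)
    {y : Fin n → ℝ} (hy : Antitone y) (hy0 : 0 ≤ y) :
    y ⬝ᵥ weightedMatrix c G *ᵥ y ≤ y ⬝ᵥ weightedMatrix c (thresholdGraph n s) *ᵥ y := by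
  have hd : ∀ i, G.degree i ≤ n - 1 := fun i => by
    have := G.degree_lt_card_verts i
    rw [Fintype.card_fin] at this
    omega
  have key : ∀ a ≤ n, ∀ b ≤ n, a ≤ b →
      ∑ i : Fin n with i.val < a, ∑ j : Fin n with j.val < b, (if G.Adj i j then 1 else 0) ≤
      ∑ i : Fin n with i.val < a, ∑ j : Fin n with j.val < b,
        (if (thresholdGraph n s).Adj i j then 1 else 0) := by
    intro a ha b hb hab
    have hm : Monotone fun t => min t (b - 1) := fun _ _ h => min_le_min_right _ h
    refine (Finset.sum_le_sum fun i hi => ?_).trans ((sum_le_sum_thresholdDegree hs h1 h2 hd hm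
      ha).trans (Finset.sum_le_sum fun i hi => ?_))
    · simp only [Finset.mem_filter, Finset.mem_univ, true_and] at hi
      rw [← Finset.sum_filter, Finset.sum_const, smul_eq_mul, mul_one, Finset.filter_filter]
      refine le_min ?_ ?_
      · rw [← card_neighborFinset_eq_degree]
        refine Finset.card_le_card fun j hj => ?_
        simp only [Finset.mem_filter, Finset.mem_univ, true_and] at hj
        simpa using hj.2
      · refine le_of_le_of_eq (Finset.card_le_card (t := (Finset.univ.filter fun j : Fin n =>
          j.val < b).erase i) fun j hj => ?_)
          (by rw [Finset.card_erase_of_mem (by simp; omega), card_filter_val_lt hb])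
        simp only [Finset.mem_filter, Finset.mem_univ, true_and, Finset.mem_erase] at hj ⊢
        exact ⟨hj.2.ne', hj.1⟩
    · simp only [Finset.mem_filter, Finset.mem_univ, true_and] at hi
      rw [← Finset.sum_filter, Finset.sum_const, smul_eq_mul, mul_one, Finset.filter_filter]
      convert min_thresholdDegree_le_card hs hb (show i.val < b by omega)
  have key' : ∀ a ≤ n, ∀ b ≤ n,
      ∑ i : Fin n with i.val < a, ∑ j : Fin n with j.val < b, (if G.Adj i j then 1 else 0) ≤
      ∑ i : Fin n with i.val < a, ∑ j : Fin n with j.val < b,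
        (if (thresholdGraph n s).Adj i j then 1 else 0) := by
    intro a ha b hb
    rcases le_total a b with h | h
    · exact key a ha b hb h
    · have := key b hb a ha h
      refine le_of_eq_of_le ?_ (this.trans_eq ?_) <;> rw [Finset.sum_comm] <;>
        exact Finset.sum_congr rfl fun i _ => Finset.sum_congr rfl fun j _ =>
          if_congr (adj_comm _ _ _) rfl rfl
  rw [dotProduct_weightedMatrix_mulVec, dotProduct_weightedMatrix_mulVec]
  refine add_le_add ?_ (mul_le_mul_of_nonneg_left ?_ hc)
  · rw [← sub_nonneg, ← Finset.sum_sub_distrib]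
    simp only [← sub_mul, ← Finset.sum_sub_distrib]
    refine sum_mul_nonneg_of_prefix hy hy0 fun a ha => ?_
    rw [Finset.sum_comm]
    simp only [← Finset.sum_mul]
    refine sum_mul_nonneg_of_prefix hy hy0 fun b hb => ?_
    rw [Finset.sum_comm]
    simp only [Finset.sum_sub_distrib]
    rw [sub_nonneg]
    exact_mod_cast key' a ha b hb
  · rw [← sub_nonneg, ← Finset.sum_sub_distrib]
    simp only [← sub_mul]
    refine sum_mul_nonneg_of_prefix (y := fun i => y i ^ 2)
      (fun i j hij => pow_le_pow_left₀ (hy0 j) (hy hij) 2) (fun i => sq_nonneg _) fun a ha => ?_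
    rw [Finset.sum_sub_distrib, sub_nonneg]
    have := (sum_le_sum_thresholdDegree hs h1 h2 hd monotone_id ha).trans
      (Finset.sum_le_sum fun i _ => thresholdDegree_le_degree hs i)
    refine le_of_eq_of_le ?_ (((Nat.cast_le (α := ℝ)).2 this).trans_eq ?_) <;> push_cast
    · rfl
    · exact Finset.sum_congr rfl fun i _ => by congr!

end Comparison
end HamSpex

namespace HamSpex
open SimpleGraph Matrix
section Main
variable {V W : Type} [Fintype V] [Fintype W] {c : ℝ}

open Classical in
/-- The largest eigenvalue of `A + c D`. -/
noncomputable def weightedIndex (c : ℝ) (G : SimpleGraph V) : ℝ :=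
  sSup (spectrum ℝ (weightedMatrix c G))

theorem isHermitian_weightedMatrix (c : ℝ) (G : SimpleGraph V) :
    (weightedMatrix c G).IsHermitian := by
  classical
  refine (isHermitian_adjMatrix ℝ G).add ?_
  have := isHermitian_degMatrix ℝ G
  rw [IsHermitian, conjTranspose_smul, this.eq, star_trivial]

theorem weightedMatrix_nonneg (hc : 0 ≤ c) (G : SimpleGraph V) (i j : V) :
    0 ≤ weightedMatrix c G i j := by
  classical
  rw [weightedMatrix, Matrix.add_apply, Matrix.smul_apply, adjMatrix_apply, degMatrix, diagonal_apply,
    smul_eq_mul]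
  split_ifs <;> positivity

theorem weightedMatrix_eq_submatrix (c : ℝ) {G : SimpleGraph V} {H : SimpleGraph W} (e : G ≃g H) :
    weightedMatrix c G = (weightedMatrix c H).submatrix e e := by
  classical
  ext i j
  simp only [weightedMatrix, Matrix.add_apply, Matrix.smul_apply, adjMatrix_apply, degMatrix, diagonal_apply,
    submatrix_apply, e.map_adj_iff, EmbeddingLike.apply_eq_iff_eq, e.degree_eq]

theorem weightedIndex_congr (c : ℝ) {G : SimpleGraph V} {H : SimpleGraph W} (e : G ≃g H) :
    weightedIndex c G = weightedIndex c H := by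
  classical
  have h := AlgEquiv.spectrum_eq (reindexAlgEquiv ℝ ℝ e.symm.toEquiv) (weightedMatrix c H)
  rw [coe_reindexAlgEquiv, reindex_apply] at h
  rw [weightedIndex, weightedIndex, ← h, weightedMatrix_eq_submatrix c e]
  rfl

theorem rho_eq_weightedIndex [Nonempty V] (G : SimpleGraph V) : rho V G = weightedIndex 0 G := by
  classical
  rw [weightedIndex, ← toReal_spectralRadius (isHermitian_weightedMatrix 0 G)
    (weightedMatrix_nonneg le_rfl G), weightedMatrix, zero_smul, add_zero, rho]

theorem q_eq_weightedIndex (G : SimpleGraph V) : q V G = weightedIndex 1 G := by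
  rw [weightedIndex, weightedMatrix, one_smul, q, signlessLaplacian]

theorem dotProduct_weightedMatrix_comp (c : ℝ) {G : SimpleGraph V} {H : SimpleGraph W}
    (e : G ≃g H) (x : W → ℝ) :
    (x ∘ e) ⬝ᵥ weightedMatrix c G *ᵥ (x ∘ e) = x ⬝ᵥ weightedMatrix c H *ᵥ x := by
  rw [weightedMatrix_eq_submatrix c e]
  have h := submatrix_mulVec_equiv (weightedMatrix c H) (x ∘ e) e e.toEquiv
  have hx : (x ∘ e) ∘ e.toEquiv.symm = x := funext fun i => congrArg x (e.apply_symm_apply i)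
  rw [hx] at h
  exact (congrArg _ h).trans (comp_equiv_dotProduct_comp_equiv _ _ e.toEquiv)

theorem dotProduct_weightedMatrix_mulVec_le [Nonempty V] (c : ℝ) (G : SimpleGraph V) (x : V → ℝ) :
    x ⬝ᵥ weightedMatrix c G *ᵥ x ≤ weightedIndex c G * (x ⬝ᵥ x) := by
  classical
  exact dotProduct_mulVec_le (isHermitian_weightedMatrix c G) x

theorem weightedMatrix_mulVec_eq_of_dotProduct_eq [Nonempty V] {G : SimpleGraph V} {x : V → ℝ}
    (h : x ⬝ᵥ weightedMatrix c G *ᵥ x = weightedIndex c G * (x ⬝ᵥ x)) :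
    weightedMatrix c G *ᵥ x = weightedIndex c G • x := by
  classical
  exact mulVec_eq_of_dotProduct_mulVec_eq (isHermitian_weightedMatrix c G) h

theorem exists_nonneg_dotProduct_eq_weightedIndex [Nonempty V] (hc : 0 ≤ c) (G : SimpleGraph V) :
    ∃ x : V → ℝ, 0 ≤ x ∧ x ≠ 0 ∧
      x ⬝ᵥ weightedMatrix c G *ᵥ x = weightedIndex c G * (x ⬝ᵥ x) := by
  classical
  exact exists_nonneg_maximizer (isHermitian_weightedMatrix c G) (weightedMatrix_nonneg hc G)

/-- Two graphs whose matrices act in the same way on a positive vector agree around a vertex `i`,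
provided that one neighbourhood of `i` contains the other. -/
theorem adj_iff_of_weightedMatrix_mulVec_eq (hc : 0 ≤ c) {G H : SimpleGraph V} {x : V → ℝ}
    (hx : ∀ i, 0 < x i) {i : V} (hGH : ∀ j, G.Adj i j → H.Adj i j)
    (h : (weightedMatrix c G *ᵥ x) i = (weightedMatrix c H *ᵥ x) i) (j : V) :
    G.Adj i j ↔ H.Adj i j := by
  classical
  refine ⟨hGH j, fun hj => ?_⟩
  by_contra hG
  rw [weightedMatrix_mulVec, weightedMatrix_mulVec] at h
  have hpos : ∀ j, 0 < x j + c * x i := fun j =>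
    add_pos_of_pos_of_nonneg (hx j) (mul_nonneg hc (hx i).le)
  refine h.not_lt (Finset.sum_lt_sum (fun l _ => ?_) ⟨j, Finset.mem_univ _, ?_⟩)
  · by_cases hl : G.Adj i l
    · rw [if_pos hl, if_pos (hGH l hl)]
    · rw [if_neg hl]
      split_ifs
      exacts [(hpos l).le, le_rfl]
  · rw [if_neg hG, if_pos hj]
    exact hpos j

theorem eq_thresholdGraph_of_mulVec_eq {n s : ℕ} (hs : 2 * s + 1 ≤ n) (hc : 0 ≤ c)
    {G : SimpleGraph (Fin n)} {x : Fin n → ℝ} (hx : ∀ i, 0 < x i)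
    (h : weightedMatrix c G *ᵥ x = weightedMatrix c (thresholdGraph n s) *ᵥ x) :
    G = thresholdGraph n s := by
  have top : ∀ i j : Fin n, i.val < s → (G.Adj i j ↔ (thresholdGraph n s).Adj i j) :=
    fun i j hi => adj_iff_of_weightedMatrix_mulVec_eq (G := G) (H := thresholdGraph n s) hc hx (fun l hl => ⟨hl.ne, Or.inl hi⟩)
      (congrFun h i) j
  have low : ∀ i j : Fin n, n - s ≤ i.val → (G.Adj i j ↔ (thresholdGraph n s).Adj i j) := by
    refine fun i j hi => (adj_iff_of_weightedMatrix_mulVec_eq (G := thresholdGraph n s) (H := G) hc hx (fun l hl => ?_)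
      (congrFun h.symm i) j).symm
    have := hl.2
    rw [adj_comm, top l i (by omega)]
    exact hl.symm
  ext i j
  rcases lt_or_ge i.val s with hi | hi
  · exact top i j hi
  rcases lt_or_ge i.val (n - s) with hi' | hi'
  · refine adj_iff_of_weightedMatrix_mulVec_eq (G := G) (H := thresholdGraph n s) hc hx (fun l hl => ?_) (congrFun h i) j
    rcases lt_or_ge l.val (n - s) with hl' | hl'
    · exact ⟨hl.ne, Or.inr (Or.inr ⟨hi', hl'⟩)⟩
    · exact ((low l i hl').1 hl.symm).symm
  · exact low i j hi'

theorem pos_of_mulVec_thresholdGraph_eq {n s : ℕ} (hs1 : 1 ≤ s) {x : Fin n → ℝ}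
    {t : ℝ} (hanti : Antitone x) (h0 : 0 ≤ x) (hne : x ≠ 0)
    (h : weightedMatrix c (thresholdGraph n s) *ᵥ x = t • x) (i : Fin n) : 0 < x i := by
  classical
  obtain ⟨k, hk⟩ := Function.ne_iff.1 hne
  let z : Fin n := ⟨0, i.pos⟩
  have hz : 0 < x z := ((h0 k).lt_of_ne' hk).trans_le (hanti (Fin.mk_le_mk.2 (Nat.zero_le _)))
  refine (h0 i).lt_of_ne' fun hi => ?_
  have hiz : i ≠ z := by
    intro h
    rw [h] at hi
    exact hz.ne' hi
  have h1 := congrFun h i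
  rw [weightedMatrix_mulVec, Pi.smul_apply, hi, Pi.zero_apply, smul_zero] at h1
  have h2 := (Finset.sum_eq_zero_iff_of_nonneg fun j _ => by
    split_ifs
    · have := h0 j
      simpa using this
    · exact le_rfl).1 h1 z (Finset.mem_univ _)
  rw [if_pos ⟨hiz, Or.inr (Or.inl hs1)⟩] at h2
  simp only [mul_zero, add_zero] at h2
  exact hz.ne' h2

theorem exists_thresholdGraph_le {n k : ℕ} (hn : 3 ≤ n) (hk : 1 ≤ k) (hc : 0 ≤ c)
    {G : SimpleGraph (Fin n)} (hG : G ∈ nonHamiltonian n k) :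
    ∃ s, k ≤ s ∧ 2 * s + 1 ≤ n ∧ weightedIndex c G ≤ weightedIndex c (thresholdGraph n s) ∧
      (weightedIndex c G = weightedIndex c (thresholdGraph n s) →
        Nonempty (G ≃g thresholdGraph n s)) := by
  classical
  have : Nonempty (Fin n) := ⟨⟨0, by omega⟩⟩
  obtain ⟨hmin, hham⟩ := hG
  obtain ⟨s, hs, hsn, h1, h2⟩ := exists_card_filter_degree_le (by simpa) hham
  rw [Fintype.card_fin] at hsn h2
  have hks : k ≤ s := hmin.trans (by convert hs)
  obtain ⟨x, hx0, hx, hxG⟩ := exists_nonneg_dotProduct_eq_weightedIndex hc G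
  let σ := Tuple.sort (-x)
  have hanti : Antitone (x ∘ σ) := fun i j hij => neg_le_neg_iff.1 (Tuple.monotone_sort (-x) hij)
  let e : G.comap σ ≃g G := Iso.comap σ G
  have hcard : ∀ t, (Finset.univ.filter fun v => (G.comap σ).degree v ≤ t).card =
      (Finset.univ.filter fun v => G.degree v ≤ t).card := fun t =>
    Finset.card_equiv σ fun i => by
      have : G.degree (σ i) = (G.comap σ).degree i := e.degree_eq i
      simp [this]
  have hle := dotProduct_weightedMatrix_le (G := G.comap σ) hsn (by have h := h1.trans_eq (hcard s).symm; convert h)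
    (by have h := h2.trans_eq (hcard _).symm; convert h) hc hanti fun i => hx0 (σ i)
  have heq : (x ∘ σ) ⬝ᵥ weightedMatrix c (G.comap σ) *ᵥ (x ∘ σ) = x ⬝ᵥ weightedMatrix c G *ᵥ x :=
    dotProduct_weightedMatrix_comp c e x
  have hnorm : (x ∘ σ) ⬝ᵥ (x ∘ σ) = x ⬝ᵥ x := comp_equiv_dotProduct_comp_equiv _ _ _
  have hT : (x ∘ σ) ⬝ᵥ weightedMatrix c (thresholdGraph n s) *ᵥ (x ∘ σ) ≤
      weightedIndex c (thresholdGraph n s) * (x ⬝ᵥ x) := by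
    rw [← hnorm]
    exact dotProduct_weightedMatrix_mulVec_le c _ _
  have hpos : 0 < x ⬝ᵥ x := by simpa using dotProduct_star_self_pos_iff.2 hx
  refine ⟨s, hks, hsn, le_of_mul_le_mul_right (by linarith) hpos, fun h => ?_⟩
  have e1 : weightedMatrix c (thresholdGraph n s) *ᵥ (x ∘ σ) =
      weightedIndex c (thresholdGraph n s) • (x ∘ σ) := by
    refine weightedMatrix_mulVec_eq_of_dotProduct_eq ?_
    rw [hnorm]
    rw [h] at hxG
    linarith
  have e2 : weightedMatrix c (G.comap σ) *ᵥ (x ∘ σ) = weightedIndex c (G.comap σ) • (x ∘ σ) := by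
    refine weightedMatrix_mulVec_eq_of_dotProduct_eq ?_
    rw [hnorm, heq, hxG, weightedIndex_congr c e]
  rw [weightedIndex_congr c e, h, ← e1] at e2
  have hne : x ∘ σ ≠ 0 := fun h0 => hx (funext fun i => by simpa using congrFun h0 (σ.symm i))
  have := eq_thresholdGraph_of_mulVec_eq hsn hc
    (pos_of_mulVec_thresholdGraph_eq (hk.trans hks) hanti (fun i => hx0 (σ i)) hne e1) e2
  exact ⟨this ▸ e.symm⟩

theorem thresholdGraph_mem_nonHamiltonian {n k s : ℕ} (hn : 3 ≤ n) (hk : 1 ≤ k) (hks : k ≤ s)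
    (hs : 2 * s + 1 ≤ n) : thresholdGraph n s ∈ nonHamiltonian n k := by
  have : Nonempty (Fin n) := ⟨⟨0, by omega⟩⟩
  refine ⟨?_, not_isHamiltonian_thresholdGraph hn (hk.trans hks) hs⟩
  have : k ≤ (thresholdGraph n s).minDegree := by
    refine le_minDegree_of_forall_le_degree _ _ fun v => ?_
    refine le_trans ?_ (thresholdDegree_le_degree hs v)
    unfold thresholdDegree
    split_ifs <;> omega
  convert this

theorem isSpex_and_isFamilyMax {P : GraphParameter} (hc : 0 ≤ c)
    (hP : ∀ (V : Type) [Fintype V] [Nonempty V] (G : SimpleGraph V), P V G = weightedIndex c G)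
    {n k : ℕ} (hn : 3 ≤ n) (hk : 1 ≤ k) :
    (2 * k + 1 ≤ n → ∃ m : ℝ, IsSpex P n k m ∧ IsFamilyMax P n k m) ∧
      SPEX P n k ⊆ extremalFamily n k := by
  have : Nonempty (Fin n) := ⟨⟨0, by omega⟩⟩
  have hext : ∀ s, 2 * s + 1 ≤ n → P _ (extremalGraph n s) = P (Fin n) (thresholdGraph n s) := by
    intro s hs
    obtain ⟨e⟩ := nonempty_iso_extremalGraph (show 2 * s ≤ n by omega)
    have : Nonempty (Fin s ⊕ (Fin s ⊕ Fin (n - 2 * s))) := this.map e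
    rw [hP, hP, weightedIndex_congr c e]
  constructor
  · intro hkn
    obtain ⟨s, hs, hmax⟩ := (Set.finite_Icc k ((n - 1) / 2)).exists_maximalFor
      (fun s => P _ (extremalGraph n s)) _ ⟨k, by simp; omega⟩
    have hs' := Set.mem_Icc.1 hs
    have hub : ∀ t ∈ Set.Icc k ((n - 1) / 2),
        P _ (extremalGraph n t) ≤ P _ (extremalGraph n s) := fun t ht =>
      (le_total _ _).elim id fun h => hmax ht h
    refine ⟨P _ (extremalGraph n s), ⟨⟨thresholdGraph n s, thresholdGraph_mem_nonHamiltonian hn hk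
      hs'.1 (by omega), (hext s (by omega)).symm⟩, ?_⟩, ⟨s, hs, rfl⟩, ?_⟩
    · rintro _ ⟨G, hG, rfl⟩
      obtain ⟨t, hkt, htn, hle, -⟩ := exists_thresholdGraph_le hn hk hc hG
      refine le_trans ?_ (hub t ⟨hkt, by omega⟩)
      simp only
      rw [hext t htn, hP, hP]
      exact hle
    · rintro _ ⟨t, ht, rfl⟩
      exact hub t ht
  · rintro G ⟨hG, hmax⟩
    obtain ⟨s, hks, hsn, hle, heq⟩ := exists_thresholdGraph_le hn hk hc hG
    have h := hmax _ (thresholdGraph_mem_nonHamiltonian hn hk hks hsn)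
    rw [hP, hP] at h
    obtain ⟨e⟩ := heq (hle.antisymm h)
    obtain ⟨e'⟩ := nonempty_iso_extremalGraph (show 2 * s ≤ n by omega)
    exact ⟨s, ⟨hks, by omega⟩, ⟨e.trans e'⟩⟩

end Main
end HamSpex

theorem mainTheorem3 (n k : ℕ) (hn : 3 ≤ n) (hk : 1 ≤ k) :
    ((2 * k + 1 ≤ n →
        ∃ m : ℝ, HamSpex.IsSpex HamSpex.rho n k m ∧ HamSpex.IsFamilyMax HamSpex.rho n k m) ∧
      HamSpex.SPEX HamSpex.rho n k ⊆ HamSpex.extremalFamily n k) ∧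
    ((2 * k + 1 ≤ n →
        ∃ m : ℝ, HamSpex.IsSpex HamSpex.q n k m ∧ HamSpex.IsFamilyMax HamSpex.q n k m) ∧
      HamSpex.SPEX HamSpex.q n k ⊆ HamSpex.extremalFamily n k) :=
  ⟨HamSpex.isSpex_and_isFamilyMax le_rfl (fun _ => HamSpex.rho_eq_weightedIndex) hn hk,
    HamSpex.isSpex_and_isFamilyMax zero_le_one (fun _ => HamSpex.q_eq_weightedIndex) hn hk⟩
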